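/- Let $k$ be an algebraically closed field of characteristic zero; all algebras are unital and associative. For a field $K$ let $K^{\oplus 3} * K^{\oplus 3}$ be the free product of unital $K$-algebras, let $p_1,p_2,p_3$ (with $p_1+p_2+p_3=1$) and $q_1,q_2,q_3$ (with $q_1+q_2+q_3=1$) be the primitive orthogonal idempotents of the first and of the second factor, and for $x=(x_{11},x_{12},x_{21},x_{22})\in K^4$ let $S_x$ be the quotient of $K^{\oplus 3}*K^{\oplus 3}$ by the two-sided ideal generated by $\sum_{i,j=1}^{2}x_{ij}[p_i,q_j]$; for $x \neq 0$ it depends only on the point $(x_{11}:x_{12}:x_{21}:x_{22})\in\mathbb P^3(K)$. Let $\mathbb F=k(y_1,y_2,y_3)$ be the field of rational functions and let $\mathcal S$ be the $\mathbb F$-algebra $S_{(1,y_1,y_2,y_3)}$, that is, the quotient of $\mathbb F^{\oplus 3}*\mathbb F^{\oplus 3}$ by the relation $$[p_1,q_1]+y_1[p_1,q_2]+y_2[p_2,q_1]+y_3[p_2,q_2]=0.$$ Then: 1. $\mathcal S$ is finite-dimensional over $\mathbb F$ and $\dim_{\mathbb F}\mathcal S\le 19$. 2. There is a faithful action of the symmetric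 group $\Sigma_3$ on $\mathbb F$ by $k$-automorphisms in which the transposition $(1\,2)$ acts by $y_1\mapsto y_3/y_2$, $y_2\mapsto 1/y_2$, $y_3\mapsto y_1/y_2$ and the transposition $(1\,3)$ acts by $y_1\mapsto y_1$, $y_2\mapsto 1-y_2$, $y_3\mapsto y_1-y_3$; and there is an action of $\Sigma_3$ on $\mathcal S$ by ring automorphisms that is semilinear over this action on $\mathbb F$ (that is, $g(cs)=g(c)\,g(s)$ for $g\in\Sigma_3$, $c\in\mathbb F$, $s\in\mathcal S$) and satisfies $g(p_i)=p_{g(i)}$ and $g(q_j)=q_j$ for all $g\in\Sigma_3$ and $i,j\in\{1,2,3\}$. 3. $\dim_{\mathbb F}\mathcal S$ is divisible by $3$. 4. $\dim_{\mathbb F}\mathcal S\le 18$. 5. There is a nonempty Zariski open subset $U\subseteq\mathbb P^3(k)$ such that $S_x$ is finite-dimensional over $k$ with $\dim_k S_x\le 18$ for every $x\in U$. -/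

import Mathlib

open scoped LinearAlgebra.Projectivization

noncomputable section

namespace PartialAbelianization

universe u

section FreeProductQuotient

variable (K : Type u) [Field K]

/-- The free product `A * B` of unital `K`-algebras, with `A = B = K ⊕ K ⊕ K`
(the index `0` stands for `A`, the index `1` for `B`). -/
abbrev FreeProd : Type u :=
  LinearAlgebra.FreeProduct K (fun _ : Fin 2 => Fin 3 → K)

/-- The three primitive orthogonal idempotents of `A`, inside `A * B`. -/
def p (i : Fin 3) : FreeProd K :=
  LinearAlgebra.FreeProduct.ι K (fun _ : Fin 2 => Fin 3 → K) 0 (Pi.single i 1)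

/-- The three primitive orthogonal idempotents of `B`, inside `A * B`. -/
def q (j : Fin 3) : FreeProd K :=
  LinearAlgebra.FreeProduct.ι K (fun _ : Fin 2 => Fin 3 → K) 1 (Pi.single j 1)

variable {K}

/-- The element `∑ x_{ij} [p_i, q_j]` of `A * B`, the sum being over the first two idempotents
of `A` and the first two idempotents of `B`. -/
def commutatorSum (x : Fin 2 × Fin 2 → K) : FreeProd K :=
  ∑ i : Fin 2, ∑ j : Fin 2,
    x (i, j) • (p K i.castSucc * q K j.castSucc - q K j.castSucc * p K i.castSucc)

/-- The algebra `S_x`: the quotient of `A * B` by the two-sided ideal generated by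
`∑ x_{ij} [p_i, q_j]`. -/
abbrev S (x : Fin 2 × Fin 2 → K) : Type u :=
  RingQuot (fun a b : FreeProd K => a = commutatorSum x ∧ b = 0)

/-- The quotient map `A * B → S_x`. -/
abbrev toS (x : Fin 2 × Fin 2 → K) : FreeProd K →ₐ[K] S x :=
  RingQuot.mkAlgHom K (fun a b : FreeProd K => a = commutatorSum x ∧ b = 0)

end FreeProductQuotient

section Generic

variable (k : Type u) [Field k]

/-- The field `𝔽 = k(y₁, y₂, y₃)`. -/
abbrev GenField : Type u := FractionRing (MvPolynomial (Fin 3) k)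

/-- The variables of `𝔽`; `y k 0`, `y k 1`, `y k 2` stand for `y₁`, `y₂`, `y₃`. -/
def y (i : Fin 3) : GenField k :=
  algebraMap (MvPolynomial (Fin 3) k) (GenField k) (MvPolynomial.X i)

/-- The coefficients `(x₁₁, x₁₂, x₂₁, x₂₂) = (1, y₁, y₂, y₃)`. -/
def genPoint (ij : Fin 2 × Fin 2) : GenField k :=
  !![1, y k 0; y k 1, y k 2] ij.1 ij.2

/-- The generic algebra `𝒮` over `𝔽`, the quotient of `𝔽³ * 𝔽³` by
`[p₁,q₁] + y₁[p₁,q₂] + y₂[p₂,q₁] + y₃[p₂,q₂]`. -/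
abbrev GenS : Type u := S (genPoint k)

/-- Zariski open subsets of the projective space `ℙ³` over `k` with coordinates `x_{ij}`:
complements of the common zero sets of families of homogeneous polynomials. -/
def IsZariskiOpen (U : Set (ℙ k (Fin 2 × Fin 2 → k))) : Prop :=
  ∃ T : Set (MvPolynomial (Fin 2 × Fin 2) k),
    (∀ f ∈ T, ∃ n : ℕ, f.IsHomogeneous n) ∧
    ∀ (v : Fin 2 × Fin 2 → k) (hv : v ≠ 0),
      Projectivization.mk k v hv ∈ U ↔ ∃ f ∈ T, MvPolynomial.eval v f ≠ 0

end Generic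

end PartialAbelianization

end

/-! Let M be the 2 × 2 matrix x bordered by a zero row and a zero column. Multiplying the relation
by `p i` on the left and `p k` on the right, i ≠ k, shows that the vector (p i q j p k)_j is killed
by row i minus row k of M; since the q j sum to 1, it is also killed by (1,1,1). It is thus
proportional to their cross product, up to sign a row of `cofactors x`. Words q j p i q l give the
columns in the same way.

If all nine cofactors are nonzero, each word p i q a p b q j is a combination of p i q j and one
further element `longWord`: two elements in each of nine Peirce corners, eighteen in all. Reducing
words of length six in two ways (`longWord_mul_mem`) shows that these span, provided each
`lengthSixDet` is nonzero. So `discriminant x ≠ 0` implies dimension at most 18; this open condition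
holds at (1:2:3:7), hence also at the generic point. The bound does not use divisibility by 3.

Adding a constant to a column of M adds a multiple of [1, q j] = 0 to the relation. One may
therefore permute the p i, then renormalise M to have last row zero and first entry one. This gives
the action on 𝔽 and, by the universal property, semilinear automorphisms of 𝒮. They carry the right
ideals p i 𝒮 to one another, so these have equal dimension and 3 divides the total. -/

open scoped LinearAlgebra.Projectivization

noncomputable section

namespace PartialAbelianization

universe u

/-! ### Reduction of words in two triples of idempotents. -/

section ProportionalWords

variable {K A : Type*} [Field K] [Ring A] [Algebra K A]

/-- The coefficients of the words `p i * q a * p b * q j` along a common element, for two families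
of three idempotents whose words of length three are governed by the matrix `c`. -/
def wordCoeff (c : Matrix (Fin 3) (Fin 3) K) (i j a b : Fin 3) : K :=
  if b = i then
    -(c (i + 2) a * c (i + 1) (j + 1) * c (i + 1) (j + 2) +
      c (i + 1) a * c (i + 2) (j + 1) * c (i + 2) (j + 2))
  else c (-(i + b)) a * c b (j + 1) * c b (j + 2)

/-- The determinant controlling whether words of length six reduce to words of length four. -/
def lengthSixDet {R : Type*} [CommRing R] (c : Matrix (Fin 3) (Fin 3) R) (j : Fin 3) : R :=
  ∑ i, c (i + 1) j * c (i + 2) j * (c i (j + 1) * c i (j + 2))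

/-- Two complete families of orthogonal idempotents such that the vectors `j ↦ p i * q j * p k`
and `i ↦ q j * p i * q l` (for `i ≠ k` and `j ≠ l`) are proportional to a row, respectively a
column, of the matrix `c`. -/
structure ProportionalWords (c : Matrix (Fin 3) (Fin 3) K) (p q : Fin 3 → A) : Prop where
  left : CompleteOrthogonalIdempotents p
  right : CompleteOrthogonalIdempotents q
  row : ∀ i k, i ≠ k → ∀ j j',
    c (-(i + k)) j' • (p i * q j * p k) = c (-(i + k)) j • (p i * q j' * p k)
  col : ∀ j l, j ≠ l → ∀ i i',
    c i' (-(j + l)) • (q j * p i * q l) = c i (-(j + l)) • (q j * p i' * q l)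

/-- The element of which the words `p i * q a * p b * q j` are multiples up to `p i * q j`. -/
def longWord (c : Matrix (Fin 3) (Fin 3) K) (p q : Fin 3 → A) (i j : Fin 3) : A :=
  (wordCoeff c i j (j + 1) (i + 1))⁻¹ • (p i * q (j + 1) * p (i + 1) * q j)

theorem wordCoeff_ne_zero {c : Matrix (Fin 3) (Fin 3) K} (hc : ∀ i j, c i j ≠ 0)
    {i b : Fin 3} (h : b ≠ i) (j a : Fin 3) : wordCoeff c i j a b ≠ 0 := by
  rw [wordCoeff, if_neg h]
  exact mul_ne_zero (mul_ne_zero (hc _ _) (hc _ _)) (hc _ _)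

theorem eq_add_one_or_eq_add_two : ∀ i b : Fin 3, b ≠ i → b = i + 1 ∨ b = i + 2 := by
  decide

namespace ProportionalWords

variable {c : Matrix (Fin 3) (Fin 3) K} {p q : Fin 3 → A}

theorem sum_left (h : ProportionalWords c p q) (i : Fin 3) :
    p i + p (i + 1) + p (i + 2) = 1 := by
  rw [← h.left.complete, Fin.sum_univ_three]
  fin_cases i <;> simp <;> abel

/-- The row condition fixes the dependence on a. The column condition for q (j+1) p b q j compares
the two values b ≠ i. Indices live in ℤ/3, so -(i + b) is the index other than i and b. -/
theorem word_of_ne (h : ProportionalWords c p q) (hc : ∀ i j, c i j ≠ 0)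
    {i b : Fin 3} (hb : b ≠ i) (j a : Fin 3) :
    p i * q a * p b * q j = wordCoeff c i j a b • longWord c p q i j := by
  have key : ∀ b, b ≠ i → p i * q (j + 1) * p b * q j =
      wordCoeff c i j (j + 1) b • longWord c p q i j := by
    intro b hb
    have h1 : i + 1 ≠ i := by clear * -; decide +revert
    have hn := wordCoeff_ne_zero hc h1 j (j + 1)
    rcases eq_add_one_or_eq_add_two i b hb with rfl | rfl
    · rw [longWord, smul_smul, mul_inv_cancel₀ hn, one_smul]
    · have hj : j + 1 ≠ j := by clear * -; decide +revert
      have hcol := congrArg (p i * ·) (h.col (j + 1) j hj (i + 2) (i + 1))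
      have e1 : -(j + 1 + j) = j + 2 := by clear * -; decide +revert
      have e2 : -(i + (i + 1)) = i + 2 := by clear * -; decide +revert
      have e3 : -(i + (i + 2)) = i + 1 := by clear * -; decide +revert
      simp only [mul_smul_comm, ← mul_assoc, e1] at hcol
      rw [← smul_right_injective A (hc (i + 1) (j + 2)) |>.eq_iff]
      simp only [hcol, longWord, smul_smul]
      congr 1
      rw [← div_eq_mul_inv, ← mul_div_assoc, eq_div_iff hn, wordCoeff, wordCoeff, if_neg hb, if_neg h1, e2, e3]
      ring
  have hrow := congrArg (· * q j) (h.row i b hb.symm a (j + 1))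
  simp only [smul_mul_assoc] at hrow
  rw [← smul_right_injective A (hc (-(i + b)) (j + 1)) |>.eq_iff]
  simp only [hrow, key b hb, smul_smul]
  congr 1
  rw [wordCoeff, wordCoeff, if_neg hb, if_neg hb]
  ring

/-- For b = i, substitute p i = 1 - p (i+1) - p (i+2): the 1 contributes p i q a q j, and the two
other terms fall under `word_of_ne`. -/
theorem word_eq (h : ProportionalWords c p q) (hc : ∀ i j, c i j ≠ 0) (i j a b : Fin 3) :
    p i * q a * p b * q j =
      (if a = j ∧ b = i then p i * q j else 0) + wordCoeff c i j a b • longWord c p q i j := by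
  by_cases hb : b = i
  · subst hb
    have h1 : b + 1 ≠ b := by clear * -; decide +revert
    have h2 : b + 2 ≠ b := by clear * -; decide +revert
    have e1 : -(b + (b + 1)) = b + 2 := by clear * -; decide +revert
    have e2 : -(b + (b + 2)) = b + 1 := by clear * -; decide +revert
    have hs : p b * q a * p b * q j =
        p b * q a * q j - p b * q a * p (b + 1) * q j - p b * q a * p (b + 2) * q j := by
      have := congrArg (fun z => p b * q a * z * q j) (h.sum_left b)
      simp only [mul_add, add_mul, mul_one] at this
      rw [← this]; abel
    rw [hs, h.word_of_ne hc h1, h.word_of_ne hc h2]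
    have hq : p b * q a * q j = if a = j ∧ b = b then p b * q j else 0 := by
      by_cases ha : a = j
      · subst ha
        simp [mul_assoc, (h.right.idem a).eq]
      · simp [ha, mul_assoc, h.right.ortho ha]
    rw [hq, sub_sub, sub_eq_add_neg, ← add_smul, ← neg_smul]
    congr 2
    simp only [wordCoeff, if_neg h1, if_neg h2, e1, e2, if_true]
  · rw [h.word_of_ne hc hb, if_neg (fun hh => hb hh.2), zero_add]

theorem word_mem (h : ProportionalWords c p q) (hc : ∀ i j, c i j ≠ 0) (i j a b : Fin 3) :
    p i * q a * p b * q j ∈ Submodule.span K {p i * q j, longWord c p q i j} := by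
  rw [h.word_eq hc]
  refine add_mem ?_ (Submodule.smul_mem _ _ (Submodule.subset_span (by simp)))
  split_ifs
  · exact Submodule.subset_span (by simp)
  · exact zero_mem _

/-- Expanding a word of length six from the left and from the right. -/
theorem smul_sub_smul_mem (h : ProportionalWords c p q) (hc : ∀ i j, c i j ≠ 0)
    (i j a b e d : Fin 3) :
    wordCoeff c i e a b • (longWord c p q i e * p d * q j) -
      wordCoeff c b j e d • (p i * q a * longWord c p q b j) ∈
        Submodule.span K {p i * q j, longWord c p q i j} := by
  have h1 := congrArg (· * p d * q j) (h.word_eq hc i e a b)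
  have h2 := congrArg (p i * q a * ·) (h.word_eq hc b j e d)
  simp only [add_mul, mul_add, smul_mul_assoc, mul_smul_comm] at h1 h2
  have h3 : p i * q a * p b * q e * p d * q j = p i * q a * (p b * q e * p d * q j) := by
    simp only [mul_assoc]
  rw [h1, h2] at h3
  have h4 : wordCoeff c i e a b • (longWord c p q i e * p d * q j) -
      wordCoeff c b j e d • (p i * q a * longWord c p q b j) =
      p i * q a * (if e = j ∧ d = b then p b * q j else 0) -
      (if a = e ∧ b = i then p i * q e else 0) * p d * q j := by
    rw [sub_eq_sub_iff_add_eq_add, add_comm, h3]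
  rw [h4]
  refine sub_mem ?_ ?_
  · split_ifs
    · rw [← mul_assoc]
      exact h.word_mem hc i j a b
    · simp
  · split_ifs
    · exact h.word_mem hc i j e d
    · simp

/-- Modulo N, `smul_sub_smul_mem` relates the unknowns longWord i e · p d q j and p i q a · longWord
b j. Eliminating the latter for e = j and two values of d leaves, as b runs over the two indices ≠
i, a 2 × 2 system with determinant a nonzero multiple of `lengthSixDet c j`. All other unknowns then
follow one at a time. -/
theorem longWord_mul_mem (h : ProportionalWords c p q) (hc : ∀ i j, c i j ≠ 0)
    (hd : ∀ j, lengthSixDet c j ≠ 0) (i j e d : Fin 3) :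
    longWord c p q i e * p d * q j ∈ Submodule.span K {p i * q j, longWord c p q i j} := by
  set N := Submodule.span K {p i * q j, longWord c p q i j}
  have h1 : i + 1 ≠ i := by clear * -; decide +revert
  have h2 : i + 2 ≠ i := by clear * -; decide +revert
  have h12 : i + 1 ≠ i + 2 := by clear * -; decide +revert
  have e10 : -(i + 1 + i) = i + 2 := by clear * -; decide +revert
  have e20 : -(i + 2 + i) = i + 1 := by clear * -; decide +revert
  have e21 : -(i + 2 + (i + 1)) = i := by clear * -; decide +revert
  have s11 : i + 1 + 1 = i + 2 := by clear * -; decide +revert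
  have s12 : i + 1 + 2 = i := by clear * -; decide +revert
  -- `longWord i j * p d * q j` for two values of `d`, by Cramer's rule
  have parallel : ∀ b, b ≠ i →
      wordCoeff c b j j (i + 1) • (longWord c p q i j * p i * q j) -
        wordCoeff c b j j i • (longWord c p q i j * p (i + 1) * q j) ∈ N := by
    intro b hb
    have m0 := h.smul_sub_smul_mem hc i j (j + 1) b j i
    have m1 := h.smul_sub_smul_mem hc i j (j + 1) b j (i + 1)
    have hne := wordCoeff_ne_zero hc hb j (j + 1)
    rw [← Submodule.smul_mem_iff _ hne]
    convert sub_mem (N.smul_mem (wordCoeff c b j j (i + 1)) m0)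
      (N.smul_mem (wordCoeff c b j j i) m1) using 1
    module
  have det_ne : wordCoeff c (i + 1) j j i * wordCoeff c (i + 2) j j (i + 1) -
      wordCoeff c (i + 1) j j (i + 1) * wordCoeff c (i + 2) j j i ≠ 0 := by
    have : wordCoeff c (i + 1) j j i * wordCoeff c (i + 2) j j (i + 1) -
      wordCoeff c (i + 1) j j (i + 1) * wordCoeff c (i + 2) j j i =
        c i (j + 1) * c i (j + 2) * lengthSixDet c j := by
      have hsum : lengthSixDet c j =
          c (i + 1) j * c (i + 2) j * (c i (j + 1) * c i (j + 2)) +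
          c (i + 2) j * c i j * (c (i + 1) (j + 1) * c (i + 1) (j + 2)) +
          c i j * c (i + 1) j * (c (i + 2) (j + 1) * c (i + 2) (j + 2)) := by
        rw [lengthSixDet, Fin.sum_univ_three]
        fin_cases i <;> simp <;> ring
      rw [hsum]
      simp only [wordCoeff, if_neg h1.symm, if_neg h12, if_neg h2.symm, e10, e20, e21, s11, s12,
        if_true]
      ring
    rw [this]
    exact mul_ne_zero (mul_ne_zero (hc _ _) (hc _ _)) (hd j)
  have t0 : longWord c p q i j * p i * q j ∈ N := by
    rw [← Submodule.smul_mem_iff _ det_ne]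
    convert sub_mem (N.smul_mem (wordCoeff c (i + 1) j j i) (parallel _ h2))
      (N.smul_mem (wordCoeff c (i + 2) j j i) (parallel _ h1)) using 1
    module
  have t1 : longWord c p q i j * p (i + 1) * q j ∈ N := by
    rw [← Submodule.smul_mem_iff _ det_ne]
    convert sub_mem (N.smul_mem (wordCoeff c (i + 1) j j (i + 1)) (parallel _ h2))
      (N.smul_mem (wordCoeff c (i + 2) j j (i + 1)) (parallel _ h1)) using 1
    module
  have right_mem : ∀ a b, p i * q a * longWord c p q b j ∈ N := by
    intro a b
    -- The coefficient of p i q a · longWord b j is certainly nonzero only for d ≠ b; of the two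
    -- solved values i and i+1 at least one qualifies.
    obtain ⟨d, hdb, hdN⟩ : ∃ d, d ≠ b ∧ longWord c p q i j * p d * q j ∈ N := by
      by_cases hb : b = i
      · exact ⟨i + 1, hb ▸ h1, t1⟩
      · exact ⟨i, Ne.symm hb, t0⟩
    rw [← Submodule.smul_mem_iff _ (wordCoeff_ne_zero hc hdb j j)]
    convert sub_mem (N.smul_mem (wordCoeff c i j a b) hdN)
      (h.smul_sub_smul_mem hc i j a b j d) using 1
    module
  -- Any a and any b ≠ i would serve; here a = e and b = i+1.
  rw [← Submodule.smul_mem_iff _ (wordCoeff_ne_zero hc h1 e e)]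
  convert add_mem (h.smul_sub_smul_mem hc i j e (i + 1) e d)
    (N.smul_mem (wordCoeff c (i + 1) j e d) (right_mem e (i + 1))) using 1
  module

/-- Eighteen words, as a spanning family of the algebra generated by the `p i` and the `q j`. -/
def spanningWords (c : Matrix (Fin 3) (Fin 3) K) (p q : Fin 3 → A) :
    Fin 2 × Fin 3 × Fin 3 → A :=
  fun t => if t.1 = 0 then p t.2.1 * q t.2.2 else longWord c p q t.2.1 t.2.2

theorem pair_span_le (c : Matrix (Fin 3) (Fin 3) K) (p q : Fin 3 → A) (i j : Fin 3) :
    Submodule.span K {p i * q j, longWord c p q i j} ≤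
      Submodule.span K (Set.range (spanningWords c p q)) := by
  rw [Submodule.span_le]
  rintro z (rfl | rfl)
  · exact Submodule.subset_span ⟨(0, i, j), by simp [spanningWords]⟩
  · exact Submodule.subset_span ⟨(1, i, j), by simp [spanningWords]⟩

/-- Inserting 1 = ∑ q j after p d turns the product into words of length four and products covered
by `longWord_mul_mem`. -/
theorem mul_left_idem_mem (h : ProportionalWords c p q) (hc : ∀ i j, c i j ≠ 0)
    (hd : ∀ j, lengthSixDet c j ≠ 0) (d : Fin 3) {z : A}
    (hz : z ∈ Submodule.span K (Set.range (spanningWords c p q))) :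
    z * p d ∈ Submodule.span K (Set.range (spanningWords c p q)) := by
  induction hz using Submodule.span_induction with
  | zero => simp
  | add x y _ _ hx hy => rw [add_mul]; exact add_mem hx hy
  | smul r x _ hx => rw [smul_mul_assoc]; exact Submodule.smul_mem _ _ hx
  | mem x hx =>
    obtain ⟨⟨s, i, e⟩, rfl⟩ := hx
    rw [← mul_one (_ * p d), ← h.right.complete, Finset.mul_sum]
    refine sum_mem fun j _ => pair_span_le c p q i j ?_
    simp only [spanningWords]
    split_ifs
    · exact h.word_mem hc i j e d
    · exact h.longWord_mul_mem hc hd i j e d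

theorem mul_right_idem_mem (h : ProportionalWords c p q) (j : Fin 3) {z : A}
    (hz : z ∈ Submodule.span K (Set.range (spanningWords c p q))) :
    z * q j ∈ Submodule.span K (Set.range (spanningWords c p q)) := by
  induction hz using Submodule.span_induction with
  | zero => simp
  | add x y _ _ hx hy => rw [add_mul]; exact add_mem hx hy
  | smul r x _ hx => rw [smul_mul_assoc]; exact Submodule.smul_mem _ _ hx
  | mem x hx =>
    obtain ⟨⟨s, i, e⟩, rfl⟩ := hx
    have hq : spanningWords c p q (s, i, e) * q j =
        if e = j then spanningWords c p q (s, i, e) else 0 := by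
      have : q e * q j = if e = j then q e else 0 := h.right.mul_eq e j
      simp only [spanningWords, longWord]
      split_ifs <;> simp_all [mul_assoc]
    rw [hq]
    split_ifs
    · exact Submodule.subset_span ⟨_, rfl⟩
    · exact zero_mem _

theorem one_mem_span (h : ProportionalWords c p q) :
    (1 : A) ∈ Submodule.span K (Set.range (spanningWords c p q)) := by
  rw [← mul_one (1 : A)]
  nth_rw 1 [← h.left.complete]
  rw [← h.right.complete, Finset.sum_mul_sum]
  exact sum_mem fun i _ => sum_mem fun j _ =>
    pair_span_le c p q i j (Submodule.subset_span (by simp))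

end ProportionalWords

end ProportionalWords

/-! ### Universal property of the quotient of the free product. -/

section UniversalProperty

variable {K : Type u} [Field K] {A : Type*} [Ring A] [Algebra K A]

/-- The algebra homomorphism out of `K ⊕ K ⊕ K` given by three orthogonal idempotents. -/
def idempotentsHom {e : Fin 3 → A} (he : CompleteOrthogonalIdempotents e) :
    (Fin 3 → K) →ₐ[K] A :=
  AlgHom.ofLinearMap (Fintype.linearCombination K e)
    (by simp [Fintype.linearCombination_apply, he.complete])
    (fun f g => by
      simp only [Fintype.linearCombination_apply, Finset.sum_mul_sum, smul_mul_smul_comm,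
        he.mul_eq, smul_ite, smul_zero, Finset.sum_ite_eq, Finset.mem_univ, if_true,
        Pi.mul_apply])

theorem idempotentsHom_single {e : Fin 3 → A} (he : CompleteOrthogonalIdempotents e)
    (i : Fin 3) : idempotentsHom (K := K) he (Pi.single i 1) = e i := by
  simp [idempotentsHom, Fintype.linearCombination_apply_single]

theorem pi_algHom_ext {f g : (Fin 3 → K) →ₐ[K] A}
    (h : ∀ i, f (Pi.single i 1) = g (Pi.single i 1)) : f = g := by
  apply AlgHom.toLinearMap_injective
  apply LinearMap.pi_ext'
  intro i
  ext
  simpa using h i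

/-- The map out of the free product given by two complete families of orthogonal idempotents. -/
def freeProdLift {P Q : Fin 3 → A} (hP : CompleteOrthogonalIdempotents P)
    (hQ : CompleteOrthogonalIdempotents Q) : FreeProd K →ₐ[K] A :=
  LinearAlgebra.FreeProduct.lift K (fun _ : Fin 2 => Fin 3 → K)
    (fun {i} => if i = 0 then idempotentsHom hP else idempotentsHom hQ)

theorem freeProdLift_p {P Q : Fin 3 → A} (hP : CompleteOrthogonalIdempotents P)
    (hQ : CompleteOrthogonalIdempotents Q) (i : Fin 3) :
    freeProdLift (K := K) hP hQ (p K i) = P i := by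
  have := LinearAlgebra.FreeProduct.lift_comp_ι K (fun _ : Fin 2 => Fin 3 → K)
    (fun {i} => if i = 0 then idempotentsHom hP else idempotentsHom hQ) (i := 0)
  exact (DFunLike.congr_fun this (Pi.single i 1)).trans
    (by rw [if_pos rfl, idempotentsHom_single])

theorem freeProdLift_q {P Q : Fin 3 → A} (hP : CompleteOrthogonalIdempotents P)
    (hQ : CompleteOrthogonalIdempotents Q) (i : Fin 3) :
    freeProdLift (K := K) hP hQ (q K i) = Q i := by
  have := LinearAlgebra.FreeProduct.lift_comp_ι K (fun _ : Fin 2 => Fin 3 → K)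
    (fun {i} => if i = 0 then idempotentsHom hP else idempotentsHom hQ) (i := 1)
  exact (DFunLike.congr_fun this (Pi.single i 1)).trans
    (by rw [if_neg (by decide), idempotentsHom_single])

theorem freeProd_algHom_ext {f g : FreeProd K →ₐ[K] A} (hp : ∀ i, f (p K i) = g (p K i))
    (hq : ∀ j, f (q K j) = g (q K j)) : f = g := by
  apply (LinearAlgebra.FreeProduct.lift K (fun _ : Fin 2 => Fin 3 → K)).symm.injective
  funext i
  fin_cases i
  · exact pi_algHom_ext hp
  · exact pi_algHom_ext hq

theorem completeOrthogonalIdempotents_p (x : Fin 2 × Fin 2 → K) :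
    CompleteOrthogonalIdempotents fun i => toS x (p K i) :=
  (CompleteOrthogonalIdempotents.single (fun _ : Fin 3 => K)).map
    ((toS x).comp (LinearAlgebra.FreeProduct.ι K (fun _ : Fin 2 => Fin 3 → K) 0)).toRingHom

theorem completeOrthogonalIdempotents_q (x : Fin 2 × Fin 2 → K) :
    CompleteOrthogonalIdempotents fun i => toS x (q K i) :=
  (CompleteOrthogonalIdempotents.single (fun _ : Fin 3 => K)).map
    ((toS x).comp (LinearAlgebra.FreeProduct.ι K (fun _ : Fin 2 => Fin 3 → K) 1)).toRingHom

theorem toS_commutatorSum (x : Fin 2 × Fin 2 → K) : toS x (commutatorSum x) = 0 := by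
  rw [← map_zero (toS x)]
  exact RingQuot.mkAlgHom_rel K ⟨rfl, rfl⟩

/-- The defining relation of `S x`, for a pair of families of elements of an algebra. -/
def relation (x : Fin 2 × Fin 2 → K) (P Q : Fin 3 → A) : A :=
  ∑ i : Fin 2, ∑ j : Fin 2,
    x (i, j) • (P i.castSucc * Q j.castSucc - Q j.castSucc * P i.castSucc)

theorem map_commutatorSum (x : Fin 2 × Fin 2 → K) (f : FreeProd K →ₐ[K] A) :
    f (commutatorSum x) = relation x (fun i => f (p K i)) (fun j => f (q K j)) := by
  simp only [commutatorSum, relation, map_sum, map_smul, map_sub, map_mul]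

theorem relation_map (x : Fin 2 × Fin 2 → K) (π : S x →ₐ[K] A) :
    relation x (fun i => π (toS x (p K i))) (fun j => π (toS x (q K j))) = 0 := by
  have := map_commutatorSum x (π.comp (toS x))
  rw [AlgHom.comp_apply, toS_commutatorSum, map_zero] at this
  exact this.symm

/-- The universal property of `S x`. -/
def liftS (x : Fin 2 × Fin 2 → K) {P Q : Fin 3 → A} (hP : CompleteOrthogonalIdempotents P)
    (hQ : CompleteOrthogonalIdempotents Q) (h : relation x P Q = 0) : S x →ₐ[K] A :=
  RingQuot.liftAlgHom K ⟨freeProdLift hP hQ, by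
    rintro _ _ ⟨rfl, rfl⟩
    rw [map_commutatorSum, map_zero]
    simpa only [freeProdLift_p, freeProdLift_q] using h⟩

theorem liftS_p (x : Fin 2 × Fin 2 → K) {P Q : Fin 3 → A} (hP : CompleteOrthogonalIdempotents P)
    (hQ : CompleteOrthogonalIdempotents Q) (h : relation x P Q = 0) (i : Fin 3) :
    liftS x hP hQ h (toS x (p K i)) = P i := by
  rw [liftS, toS, RingQuot.liftAlgHom_mkAlgHom_apply, freeProdLift_p]

theorem liftS_q (x : Fin 2 × Fin 2 → K) {P Q : Fin 3 → A} (hP : CompleteOrthogonalIdempotents P)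
    (hQ : CompleteOrthogonalIdempotents Q) (h : relation x P Q = 0) (i : Fin 3) :
    liftS x hP hQ h (toS x (q K i)) = Q i := by
  rw [liftS, toS, RingQuot.liftAlgHom_mkAlgHom_apply, freeProdLift_q]

theorem S_algHom_ext {x : Fin 2 × Fin 2 → K} {f g : S x →ₐ[K] A}
    (hp : ∀ i, f (toS x (p K i)) = g (toS x (p K i)))
    (hq : ∀ j, f (toS x (q K j)) = g (toS x (q K j))) : f = g :=
  RingQuot.ringQuot_ext' K _ _ (freeProd_algHom_ext hp hq)

/-- By the universal property π factors through B, and uniqueness identifies the composite with π.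
-/
theorem map_mem_of_generators {x : Fin 2 × Fin 2 → K} (π : S x →ₐ[K] A) (B : Subalgebra K A)
    (hp : ∀ i, π (toS x (p K i)) ∈ B) (hq : ∀ j, π (toS x (q K j)) ∈ B) (s : S x) : π s ∈ B := by
  have inj : Function.Injective B.val := Subtype.val_injective
  have hP : CompleteOrthogonalIdempotents fun i => (⟨_, hp i⟩ : B) :=
    (CompleteOrthogonalIdempotents.map_injective_iff B.val.toRingHom inj).1
      ((completeOrthogonalIdempotents_p x).map π.toRingHom)
  have hQ : CompleteOrthogonalIdempotents fun i => (⟨_, hq i⟩ : B) :=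
    (CompleteOrthogonalIdempotents.map_injective_iff B.val.toRingHom inj).1
      ((completeOrthogonalIdempotents_q x).map π.toRingHom)
  have hR : relation x (fun i => (⟨_, hp i⟩ : B)) (fun i => (⟨_, hq i⟩ : B)) = 0 := by
    apply inj
    rw [map_zero, ← relation_map x π]
    simp only [relation, map_sum, map_smul, map_sub, map_mul]
    rfl
  have : B.val.comp (liftS x hP hQ hR) = π :=
    S_algHom_ext (fun i => by rw [AlgHom.comp_apply, liftS_p]; rfl)
      (fun i => by rw [AlgHom.comp_apply, liftS_q]; rfl)
  rw [← this]
  exact (liftS x hP hQ hR s).2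

end UniversalProperty

/-! ### The polynomial defining the open set. -/

section Discriminant

/-- The matrix with zero row and column sums encoding the point `x`. -/
def cofactors {R : Type*} [CommRing R] (x : Fin 2 × Fin 2 → R) : Matrix (Fin 3) (Fin 3) R :=
  !![-x (1, 1), x (1, 0), x (1, 1) - x (1, 0);
    x (0, 1), -x (0, 0), x (0, 0) - x (0, 1);
    x (1, 1) - x (0, 1), x (0, 0) - x (1, 0), x (0, 1) + x (1, 0) - x (0, 0) - x (1, 1)]

/-- The polynomial whose nonvanishing at `x` bounds the dimension of `S x`. -/
def discriminant {R : Type*} [CommRing R] (x : Fin 2 × Fin 2 → R) : R :=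
  (∏ i, ∏ j, cofactors x i j) * ∏ j, lengthSixDet (cofactors x) j

theorem map_cofactors {R R' : Type*} [CommRing R] [CommRing R'] (f : R →+* R')
    (x : Fin 2 × Fin 2 → R) (i j : Fin 3) :
    f (cofactors x i j) = cofactors (fun t => f (x t)) i j := by
  fin_cases i <;> fin_cases j <;> simp [cofactors]

theorem map_discriminant {R R' : Type*} [CommRing R] [CommRing R'] (f : R →+* R')
    (x : Fin 2 × Fin 2 → R) : f (discriminant x) = discriminant fun t => f (x t) := by
  simp only [discriminant, lengthSixDet, map_mul, map_prod, map_sum, map_cofactors]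

theorem cofactors_smul {R : Type*} [CommRing R] (a : R) (x : Fin 2 × Fin 2 → R) (i j : Fin 3) :
    cofactors (a • x) i j = a * cofactors x i j := by
  fin_cases i <;> fin_cases j <;> simp [cofactors] <;> ring

/-- The degree is 21 = 9 + 3 · 4: nine linear cofactors and three quartic determinants. -/
theorem discriminant_smul {R : Type*} [CommRing R] (a : R) (x : Fin 2 × Fin 2 → R) :
    discriminant (a • x) = a ^ 21 * discriminant x := by
  simp only [discriminant, lengthSixDet, cofactors_smul, Fin.prod_univ_three, Fin.sum_univ_three]
  ring

theorem isHomogeneous_discriminant (R : Type*) [CommRing R] :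
    (discriminant (MvPolynomial.X : Fin 2 × Fin 2 → MvPolynomial (Fin 2 × Fin 2) R)).IsHomogeneous
      21 := by
  have hc : ∀ i j, (cofactors
      (MvPolynomial.X : Fin 2 × Fin 2 → MvPolynomial (Fin 2 × Fin 2) R) i j).IsHomogeneous 1 := by
    have hX := fun t : Fin 2 × Fin 2 => MvPolynomial.isHomogeneous_X R t
    intro i j
    fin_cases i <;> fin_cases j
    · exact (hX _).neg
    · exact hX _
    · exact (hX _).sub (hX _)
    · exact hX _
    · exact (hX _).neg
    · exact (hX _).sub (hX _)
    · exact (hX _).sub (hX _)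
    · exact (hX _).sub (hX _)
    · exact (((hX _).add (hX _)).sub (hX _)).sub (hX _)
  have h1 := MvPolynomial.IsHomogeneous.prod Finset.univ
    (fun i : Fin 3 => ∏ j, cofactors
      (MvPolynomial.X : Fin 2 × Fin 2 → MvPolynomial (Fin 2 × Fin 2) R) i j)
    (fun _ => ∑ _j : Fin 3, 1)
    (fun i _ => MvPolynomial.IsHomogeneous.prod _ _ _ fun j _ => hc i j)
  have h2 := MvPolynomial.IsHomogeneous.prod Finset.univ
    (lengthSixDet (cofactors
      (MvPolynomial.X : Fin 2 × Fin 2 → MvPolynomial (Fin 2 × Fin 2) R)))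
    (fun _ => 4)
    (fun j _ => MvPolynomial.IsHomogeneous.sum _ _ _ fun i _ =>
      ((hc _ _).mul (hc _ _)).mul ((hc _ _).mul (hc _ _)))
  exact h1.mul h2

theorem discriminant_ne_zero_of_charZero (K : Type*) [Field K] [CharZero K] :
    discriminant (fun t : Fin 2 × Fin 2 => (!![1, 2; 3, 7] : Matrix (Fin 2) (Fin 2) K) t.1 t.2)
      ≠ 0 := by
  simp only [discriminant, lengthSixDet, Fin.prod_univ_three, Fin.sum_univ_three]
  have e : (2 : Fin 3) + 1 = 0 ∧ (2 : Fin 3) + 2 = 1 ∧ (1 : Fin 3) + 1 = 2 ∧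
    (1 : Fin 3) + 2 = 0 ∧ (0 : Fin 3) + 1 = 1 ∧ (0 : Fin 3) + 2 = 2 := by decide
  obtain ⟨e1, e2, e3, e4, e5, e6⟩ := e
  simp only [e1, e2, e3, e4, e5, e6]
  simp [cofactors]
  norm_num

end Discriminant

/-! ### From the relation to the bound 18. -/

section DimensionBound

variable {K : Type u} [Field K]

/-- The vector of coefficients is the cross product (1,1,1) × v. -/
theorem smul_eq_smul_of_sum_eq_zero {M : Type*} [AddCommGroup M] [Module K M]
    {v : Fin 3 → K} {t : Fin 3 → M} (h1 : ∑ j, t j = 0) (hv : ∑ j, v j • t j = 0)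
    (j j' : Fin 3) :
    (![v 2 - v 1, v 0 - v 2, v 1 - v 0] : Fin 3 → K) j' • t j =
      (![v 2 - v 1, v 0 - v 2, v 1 - v 0] : Fin 3 → K) j • t j' := by
  rw [Fin.sum_univ_three] at h1 hv
  have h2 : t 2 = -(t 0 + t 1) := by rw [← add_eq_zero_iff_neg_eq.1 h1]
  rw [h2] at hv
  have key : (v 0 - v 2) • t 0 = (v 2 - v 1) • t 1 := by
    rw [← sub_eq_zero, ← hv]; module
  fin_cases j <;> fin_cases j' <;> simp [h2]
  · exact key
  · linear_combination (norm := module) key.symm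
  · exact key.symm
  · linear_combination (norm := module) key
  · linear_combination (norm := module) key
  · linear_combination (norm := module) key.symm

/-- The point `x` as a `3 × 3` matrix of coefficients of commutators. -/
def extendedCoeff (x : Fin 2 × Fin 2 → K) : Matrix (Fin 3) (Fin 3) K :=
  !![x (0, 0), x (0, 1), 0; x (1, 0), x (1, 1), 0; 0, 0, 0]

theorem relation_eq_sum {A : Type*} [Ring A] [Algebra K A] (x : Fin 2 × Fin 2 → K)
    (P Q : Fin 3 → A) :
    relation x P Q = ∑ i, ∑ j, extendedCoeff x i j • (P i * Q j - Q j * P i) := by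
  simp [relation, extendedCoeff, Fin.sum_univ_three]

/-- The cross product changes sign when i and k are exchanged, whereas -(i + k) does not see the
order; ε = ±1 absorbs this, and proportionality is insensitive to it. -/
theorem cofactors_row (x : Fin 2 × Fin 2 → K) {i k : Fin 3} (hik : i ≠ k) :
    ∃ ε : K, ∀ j, cofactors x (-(i + k)) j = ε *
      (![(extendedCoeff x i 2 - extendedCoeff x k 2) - (extendedCoeff x i 1 - extendedCoeff x k 1),
        (extendedCoeff x i 0 - extendedCoeff x k 0) - (extendedCoeff x i 2 - extendedCoeff x k 2),
        (extendedCoeff x i 1 - extendedCoeff x k 1) - (extendedCoeff x i 0 - extendedCoeff x k 0)] :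
          Fin 3 → K) j := by
  have key : ∀ a b : Fin 3, b = a + 1 → ∀ j, cofactors x (-(a + b)) j =
      (![(extendedCoeff x a 2 - extendedCoeff x b 2) - (extendedCoeff x a 1 - extendedCoeff x b 1),
        (extendedCoeff x a 0 - extendedCoeff x b 0) - (extendedCoeff x a 2 - extendedCoeff x b 2),
        (extendedCoeff x a 1 - extendedCoeff x b 1) - (extendedCoeff x a 0 - extendedCoeff x b 0)] :
          Fin 3 → K) j := by
    rintro a b rfl j
    have e : -((0 : Fin 3) + (0 + 1)) = 2 ∧ -((1 : Fin 3) + (1 + 1)) = 0 ∧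
      -((2 : Fin 3) + (2 + 1)) = 1 ∧ (0 : Fin 3) + 1 = 1 ∧ (1 : Fin 3) + 1 = 2 ∧
      (2 : Fin 3) + 1 = 0 := by decide
    obtain ⟨e1, e2, e3, e4, e5, e6⟩ := e
    fin_cases a <;> fin_cases j <;>
      simp only [Fin.zero_eta, Fin.mk_one, Fin.reduceFinMk, e1, e2, e3] <;>
      simp [cofactors, extendedCoeff] <;> ring
  rcases eq_add_one_or_eq_add_two i k hik.symm with hk | hk
  · exact ⟨1, fun j => by rw [key i k hk, one_mul]⟩
  · have hi : i = k + 1 := by rw [hk, add_assoc]; exact (add_zero i).symm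
    refine ⟨-1, fun j => ?_⟩
    rw [add_comm, key k i hi]
    fin_cases j <;> simp <;> ring

theorem cofactors_transpose (x : Fin 2 × Fin 2 → K) (i j : Fin 3) :
    cofactors x i j = cofactors (fun t => x t.swap) j i := by
  fin_cases i <;> fin_cases j <;> simp [cofactors]
  ring

theorem extendedCoeff_transpose (x : Fin 2 × Fin 2 → K) (i j : Fin 3) :
    extendedCoeff x i j = extendedCoeff (fun t => x t.swap) j i := by
  fin_cases i <;> fin_cases j <;> simp [extendedCoeff]

theorem cofactors_col (x : Fin 2 × Fin 2 → K) {j l : Fin 3} (hjl : j ≠ l) :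
    ∃ ε : K, ∀ i, cofactors x i (-(j + l)) = ε *
      (![(extendedCoeff x 2 l - extendedCoeff x 2 j) - (extendedCoeff x 1 l - extendedCoeff x 1 j),
        (extendedCoeff x 0 l - extendedCoeff x 0 j) - (extendedCoeff x 2 l - extendedCoeff x 2 j),
        (extendedCoeff x 1 l - extendedCoeff x 1 j) - (extendedCoeff x 0 l - extendedCoeff x 0 j)] :
          Fin 3 → K) i := by
  simp only [cofactors_transpose x, extendedCoeff_transpose x]
  rw [add_comm]
  exact cofactors_row _ hjl.symm

theorem proportionalWords_of_relation {A : Type*} [Ring A] [Algebra K A]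
    {x : Fin 2 × Fin 2 → K} {P Q : Fin 3 → A} (hP : CompleteOrthogonalIdempotents P)
    (hQ : CompleteOrthogonalIdempotents Q) (h : relation x P Q = 0) :
    ProportionalWords (cofactors x) P Q where
  left := hP
  right := hQ
  row i k hik j j' := by
    rw [relation_eq_sum] at h
    have s1 : ∑ j, P i * Q j * P k = 0 := by
      rw [← Finset.sum_mul, ← Finset.mul_sum, hQ.complete, mul_one, hP.ortho hik]
    have s2 : ∑ j, (extendedCoeff x i j - extendedCoeff x k j) • (P i * Q j * P k) = 0 := by
      have hterm : ∀ l j, P i * (P l * Q j - Q j * P l) * P k =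
          (if i = l then P i * Q j * P k else 0) - if l = k then P i * Q j * P k else 0 := by
        intro l j
        rw [mul_sub, sub_mul, ← mul_assoc, hP.mul_eq, ← mul_assoc, mul_assoc _ (P l), hP.mul_eq]
        split_ifs <;> simp_all
      have h0 := congrArg (fun z => P i * z * P k) h
      simp only [Finset.mul_sum, Finset.sum_mul, mul_smul_comm, smul_mul_assoc, hterm, mul_zero,
        zero_mul] at h0
      rw [Finset.sum_comm] at h0
      simpa [Finset.sum_sub_distrib, sub_smul, smul_sub, smul_ite] using h0
    have s3 := smul_eq_smul_of_sum_eq_zero (K := K) (M := A) s1 s2 j j'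
    obtain ⟨ε, hε⟩ := cofactors_row x hik
    rw [hε, hε, mul_smul, mul_smul, s3]
  col j l hjl i i' := by
    rw [relation_eq_sum] at h
    have s1 : ∑ i, Q j * P i * Q l = 0 := by
      rw [← Finset.sum_mul, ← Finset.mul_sum, hP.complete, mul_one, hQ.ortho hjl]
    have s2 : ∑ i, (extendedCoeff x i l - extendedCoeff x i j) • (Q j * P i * Q l) = 0 := by
      have hterm : ∀ i m, Q j * (P i * Q m - Q m * P i) * Q l =
          (if m = l then Q j * P i * Q l else 0) - if j = m then Q j * P i * Q l else 0 := by
        intro i m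
        rw [mul_sub, sub_mul, ← mul_assoc, mul_assoc _ (Q m) (Q l), ← mul_assoc (Q j) (Q m),
          hQ.mul_eq, hQ.mul_eq]
        split_ifs <;> simp_all
      have h0 := congrArg (fun z => Q j * z * Q l) h
      simp only [Finset.mul_sum, Finset.sum_mul, mul_smul_comm, smul_mul_assoc, hterm, mul_zero,
        zero_mul] at h0
      simpa [Finset.sum_sub_distrib, sub_smul, smul_sub, smul_ite] using h0
    have s3 := smul_eq_smul_of_sum_eq_zero (K := K) (M := A) s1 s2 i i'
    obtain ⟨ε, hε⟩ := cofactors_col x hjl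
    rw [hε, hε, mul_smul, mul_smul, s3]

/-- The elements s with M s ⊆ M form a subalgebra containing the generators, hence the whole image
of π; apply this to 1 ∈ M. -/
theorem ProportionalWords.map_mem_span {A : Type*} [Ring A] [Algebra K A]
    {x : Fin 2 × Fin 2 → K} (π : S x →ₐ[K] A) {c : Matrix (Fin 3) (Fin 3) K}
    (h : ProportionalWords c (fun i => π (toS x (p K i))) fun j => π (toS x (q K j)))
    (hc : ∀ i j, c i j ≠ 0) (hd : ∀ j, lengthSixDet c j ≠ 0) (s : S x) :
    π s ∈ Submodule.span K (Set.range (spanningWords c (fun i => π (toS x (p K i)))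
      fun j => π (toS x (q K j)))) := by
  set M := Submodule.span K (Set.range (spanningWords c (fun i => π (toS x (p K i)))
      fun j => π (toS x (q K j))))
  let B : Subalgebra K A :=
    { carrier := {s | ∀ z ∈ M, z * s ∈ M}
      mul_mem' := fun {a b} ha hb z hz => by
        rw [← mul_assoc]
        exact hb _ (ha z hz)
      add_mem' := fun {a b} ha hb z hz => by
        rw [mul_add]
        exact add_mem (ha z hz) (hb z hz)
      algebraMap_mem' := fun r z hz => by
        rw [← Algebra.commutes, ← Algebra.smul_def]
        exact Submodule.smul_mem _ r hz }
  have hs : π s ∈ B := map_mem_of_generators π B (fun i z hz => h.mul_left_idem_mem hc hd i hz)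
    (fun j z hz => h.mul_right_idem_mem j hz) s
  simpa using hs 1 h.one_mem_span

theorem finite_and_finrank_le_of_surjective {A : Type*} [Ring A] [Algebra K A]
    {x : Fin 2 × Fin 2 → K} (hx : discriminant x ≠ 0) (π : S x →ₐ[K] A)
    (hπ : Function.Surjective π) : Module.Finite K A ∧ Module.finrank K A ≤ 18 := by
  classical
  rw [discriminant, mul_ne_zero_iff, Finset.prod_ne_zero_iff, Finset.prod_ne_zero_iff] at hx
  have hc : ∀ i j, cofactors x i j ≠ 0 := fun i j =>
    Finset.prod_ne_zero_iff.1 (hx.1 i (Finset.mem_univ _)) j (Finset.mem_univ _)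
  have hd : ∀ j, lengthSixDet (cofactors x) j ≠ 0 := fun j => hx.2 j (Finset.mem_univ _)
  have h : ProportionalWords (cofactors x) (fun i => π (toS x (p K i)))
      fun j => π (toS x (q K j)) :=
    proportionalWords_of_relation ((completeOrthogonalIdempotents_p x).map π.toRingHom)
      ((completeOrthogonalIdempotents_q x).map π.toRingHom) (relation_map x π)
  set w := ProportionalWords.spanningWords (cofactors x) (fun i => π (toS x (p K i)))
    (fun j => π (toS x (q K j)))
  have htop : Submodule.span K (Set.range w) = ⊤ := by
    refine eq_top_iff.2 fun a _ => ?_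
    obtain ⟨s, rfl⟩ := hπ a
    exact h.map_mem_span π hc hd s
  refine ⟨⟨⟨Finset.univ.image w, by simpa using htop⟩⟩, ?_⟩
  have := finrank_range_le_card (R := K) w
  rw [Set.finrank, htop, finrank_top] at this
  simpa using this

theorem S_finite_and_finrank_le {x : Fin 2 × Fin 2 → K} (hx : discriminant x ≠ 0) :
    Module.Finite K (S x) ∧ Module.finrank K (S x) ≤ 18 :=
  finite_and_finrank_le_of_surjective (A := S x) hx (AlgHom.id K (S x)) Function.surjective_id

end DimensionBound

/-! ### Nonvanishing of the discriminant: an open set and the generic point. -/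

section OpenSet

variable (k : Type u) [Field k]

/-- The points of `ℙ³` at which the discriminant does not vanish. -/
def nonvanishingLocus : Set (ℙ k (Fin 2 × Fin 2 → k)) :=
  {P | discriminant P.rep ≠ 0}

theorem mk_mem_nonvanishingLocus (v : Fin 2 × Fin 2 → k) (hv : v ≠ 0) :
    Projectivization.mk k v hv ∈ nonvanishingLocus k ↔ discriminant v ≠ 0 := by
  obtain ⟨a, ha⟩ := Projectivization.exists_smul_eq_mk_rep k v hv
  rw [nonvanishingLocus, Set.mem_ofPred_eq, ← ha, Units.smul_def, discriminant_smul]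
  simp

theorem isZariskiOpen_nonvanishingLocus : IsZariskiOpen k (nonvanishingLocus k) := by
  refine ⟨{discriminant MvPolynomial.X}, ?_, fun v hv => ?_⟩
  · rintro _ rfl
    exact ⟨21, isHomogeneous_discriminant k⟩
  · rw [mk_mem_nonvanishingLocus]
    simp [map_discriminant]

theorem nonvanishingLocus_nonempty [CharZero k] : (nonvanishingLocus k).Nonempty := by
  refine ⟨Projectivization.mk k
    (fun t : Fin 2 × Fin 2 => (!![1, 2; 3, 7] : Matrix (Fin 2) (Fin 2) k) t.1 t.2) ?_, ?_⟩
  · intro h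
    simpa using congrFun h (0, 0)
  · rw [mk_mem_nonvanishingLocus]
    exact discriminant_ne_zero_of_charZero k

/-- Specialising y to (2,3,7) gives the point (1:2:3:7), where the discriminant is nonzero. -/
theorem discriminant_genPoint_ne_zero [CharZero k] : discriminant (genPoint k) ≠ 0 := by
  let P : Fin 2 × Fin 2 → MvPolynomial (Fin 3) k := fun t =>
    (!![1, MvPolynomial.X 0; MvPolynomial.X 1, MvPolynomial.X 2] :
      Matrix (Fin 2) (Fin 2) (MvPolynomial (Fin 3) k)) t.1 t.2
  have h1 : discriminant (genPoint k) = algebraMap _ (GenField k) (discriminant P) := by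
    rw [map_discriminant]
    congr 1
    funext ⟨i, j⟩
    fin_cases i <;> fin_cases j <;> simp [genPoint, P, y]
  have h2 : MvPolynomial.eval ![2, 3, 7] (discriminant P) ≠ 0 := by
    rw [map_discriminant]
    convert discriminant_ne_zero_of_charZero k using 2
    funext ⟨i, j⟩
    fin_cases i <;> fin_cases j <;> simp [P]
  rw [h1]
  intro h
  rw [map_eq_zero_iff _ (IsFractionRing.injective _ _)] at h
  simp [h] at h2

end OpenSet

/-! ### The action of Σ₃ on the rational function field. -/

section FieldAction

variable (k : Type u) [Field k]

/-- The coefficients `1, y₁, y₂, y₃` as a `3 × 3` matrix, bordered by zeros. -/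
abbrev genMatrix : Matrix (Fin 3) (Fin 3) (GenField k) := extendedCoeff (genPoint k)

theorem genMatrix_eq : genMatrix k = !![1, y k 0, 0; y k 1, y k 2, 0; 0, 0, 0] := by
  simp [genMatrix, extendedCoeff, genPoint]

/-- The same matrix with polynomial entries. -/
def polyMatrix : Matrix (Fin 3) (Fin 3) (MvPolynomial (Fin 3) k) :=
  !![1, MvPolynomial.X 0, 0; MvPolynomial.X 1, MvPolynomial.X 2, 0; 0, 0, 0]

theorem algebraMap_polyMatrix (i j : Fin 3) :
    algebraMap _ (GenField k) (polyMatrix k i j) = genMatrix k i j := by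
  rw [genMatrix_eq]
  fin_cases i <;> fin_cases j <;> simp [polyMatrix, y]

theorem genField_algHom_ext {f g : GenField k →ₐ[k] GenField k}
    (h : ∀ i j, f (genMatrix k i j) = g (genMatrix k i j)) : f = g := by
  apply IsLocalization.algHom_ext (nonZeroDivisors (MvPolynomial (Fin 3) k))
  apply MvPolynomial.algHom_ext
  rw [genMatrix_eq] at h
  intro i
  fin_cases i
  · exact h 0 1
  · exact h 1 0
  · exact h 1 1

/-- The ratio to which the permutation `g` sends the matrix entry `i j`. -/
def permRatio (g : Equiv.Perm (Fin 3)) (i j : Fin 3) : GenField k :=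
  (genMatrix k (g i) j - genMatrix k (g 2) j) / (genMatrix k (g 0) 0 - genMatrix k (g 2) 0)

theorem permRatio_two_left (g : Equiv.Perm (Fin 3)) (j : Fin 3) : permRatio k g 2 j = 0 := by
  simp [permRatio]

theorem permRatio_two_right (g : Equiv.Perm (Fin 3)) (i : Fin 3) : permRatio k g i 2 = 0 := by
  have : ∀ i, genMatrix k i 2 = 0 := fun i => by
    rw [genMatrix_eq]; fin_cases i <;> simp
  simp only [permRatio, this, sub_zero, zero_div]

theorem isTranscendenceBasis_y : IsTranscendenceBasis k (y k) :=
  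
  have := IsLocalization.isAlgebraic (S := GenField k) (nonZeroDivisors (MvPolynomial (Fin 3) k))
  (IsTranscendenceBasis.mvPolynomial (Fin 3) k).algebraMap_comp (A := GenField k)

variable [CharZero k]

theorem genMatrix_sub_ne_zero {i j : Fin 3} (h : i ≠ j) :
    genMatrix k i 0 - genMatrix k j 0 ≠ 0 := by
  rw [← algebraMap_polyMatrix, ← algebraMap_polyMatrix, ← map_sub]
  intro h0
  rw [map_eq_zero_iff _ (IsFractionRing.injective _ _)] at h0
  have := congrArg (MvPolynomial.eval ![2, 3, 7]) h0
  revert h this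
  fin_cases i <;> fin_cases j <;> simp [polyMatrix] <;> norm_num

theorem permRatio_zero_zero (g : Equiv.Perm (Fin 3)) : permRatio k g 0 0 = 1 :=
  div_self (genMatrix_sub_ne_zero k (fun h => by simpa using g.injective h))

/-- The images of the variables under the permutation `g`. -/
def permImage (g : Equiv.Perm (Fin 3)) : Fin 3 → GenField k :=
  ![permRatio k g 0 1, permRatio k g 1 0, permRatio k g 1 1]

/-- Normalising again with g⁻¹ undoes g, so the original variables are rational functions of their
images. -/
theorem genMatrix_eq_permRatio_div (g : Equiv.Perm (Fin 3)) (i j : Fin 3) :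
    genMatrix k i j = (permRatio k g (g⁻¹ i) j - permRatio k g (g⁻¹ 2) j) /
      (permRatio k g (g⁻¹ 0) 0 - permRatio k g (g⁻¹ 2) 0) := by
  have hne : genMatrix k (g 0) 0 - genMatrix k (g 2) 0 ≠ 0 :=
    genMatrix_sub_ne_zero k (fun h => by simpa using g.injective h)
  have h2 : ∀ j, genMatrix k 2 j = 0 := fun j => by
    rw [genMatrix_eq]; fin_cases j <;> simp
  have h0 : genMatrix k 0 0 = 1 := by rw [genMatrix_eq]; simp
  have hinv : ∀ l, g (g⁻¹ l) = l := g.apply_symm_apply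
  simp only [permRatio, hinv, div_sub_div_same, sub_sub_sub_cancel_right]
  rw [div_div_div_cancel_right₀ hne, h2, h2, h0]
  simp

/-- The field is algebraic over the subalgebra generated by the three images, and its transcendence
degree is 3, so they are independent. -/
theorem algebraicIndependent_permImage (g : Equiv.Perm (Fin 3)) :
    AlgebraicIndependent k (permImage k g) := by
  set R := Algebra.adjoin k (Set.range (permImage k g))
  have hz : ∀ i, IsAlgebraic R (permImage k g i) := fun i =>
    isAlgebraic_algebraMap (⟨_, Algebra.subset_adjoin ⟨i, rfl⟩⟩ : R)
  have hratio : ∀ i j, IsAlgebraic R (permRatio k g i j) := by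
    intro i j
    fin_cases i <;> fin_cases j
    · simpa [permRatio_zero_zero] using isAlgebraic_one
    · exact hz 0
    · simpa [permRatio_two_right] using isAlgebraic_zero
    · exact hz 1
    · exact hz 2
    · simpa [permRatio_two_right] using isAlgebraic_zero
    all_goals simpa [permRatio_two_left] using isAlgebraic_zero
  have hmat : ∀ i j, IsAlgebraic R (genMatrix k i j) := by
    intro i j
    rw [genMatrix_eq_permRatio_div k g, div_eq_mul_inv]
    exact ((hratio _ _).sub (hratio _ _)).mul ((hratio _ _).sub (hratio _ _)).inv
  have hy : ∀ i, IsAlgebraic R (y k i) := by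
    intro i
    fin_cases i
    · simpa [genMatrix_eq] using hmat 0 1
    · simpa [genMatrix_eq] using hmat 1 0
    · simpa [genMatrix_eq] using hmat 1 1
  have hpoly : ∀ f : MvPolynomial (Fin 3) k, IsAlgebraic R (algebraMap _ (GenField k) f) := by
    intro f
    induction f using MvPolynomial.induction_on with
    | C a =>
      have : algebraMap (MvPolynomial (Fin 3) k) (GenField k) (MvPolynomial.C a) =
          algebraMap R (GenField k) (algebraMap k R a) := by
        rw [← IsScalarTower.algebraMap_apply k R, ← MvPolynomial.algebraMap_eq,
          ← IsScalarTower.algebraMap_apply]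
      rw [this]
      exact isAlgebraic_algebraMap _
    | add p q hp hq => rw [map_add]; exact hp.add hq
    | mul_X p i hp => rw [map_mul]; exact hp.mul (hy i)
  have : Algebra.IsAlgebraic R (GenField k) := by
    refine ⟨fun w => ?_⟩
    obtain ⟨a, b, -, rfl⟩ := IsFractionRing.div_surjective (MvPolynomial (Fin 3) k) w
    rw [div_eq_mul_inv]
    exact (hpoly a).mul (hpoly b).inv
  refine (Algebra.IsAlgebraic.isTranscendenceBasis_of_lift_le_trdeg_of_finite k (permImage k g) ?_).1
  exact (isTranscendenceBasis_y k).lift_cardinalMk_eq_trdeg.le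

/-- The endomorphism of the field of rational functions given by the permutation `g`. -/
def fieldHom (g : Equiv.Perm (Fin 3)) : GenField k →ₐ[k] GenField k :=
  IsFractionRing.liftAlgHom (g := MvPolynomial.aeval (permImage k g))
    (algebraicIndependent_iff_injective_aeval.1 (algebraicIndependent_permImage k g))

theorem fieldHom_y (g : Equiv.Perm (Fin 3)) (i : Fin 3) :
    fieldHom k g (y k i) = permImage k g i := by
  rw [fieldHom, IsFractionRing.liftAlgHom_apply, y, IsFractionRing.lift_algebraMap]
  simp

theorem fieldHom_genMatrix (g : Equiv.Perm (Fin 3)) (i j : Fin 3) :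
    fieldHom k g (genMatrix k i j) = permRatio k g i j := by
  rw [genMatrix_eq]
  fin_cases i <;> fin_cases j <;>
    simp [fieldHom_y, permImage, permRatio_zero_zero, permRatio_two_right, permRatio_two_left]

theorem fieldHom_mul (g h : Equiv.Perm (Fin 3)) :
    fieldHom k (g * h) = (fieldHom k g).comp (fieldHom k h) := by
  have hne : genMatrix k (g 0) 0 - genMatrix k (g 2) 0 ≠ 0 :=
    genMatrix_sub_ne_zero k (fun h => by simpa using g.injective h)
  refine genField_algHom_ext k fun i j => ?_
  rw [AlgHom.comp_apply, fieldHom_genMatrix, fieldHom_genMatrix]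
  simp only [permRatio, map_div₀, map_sub, fieldHom_genMatrix, Equiv.Perm.mul_apply,
    div_sub_div_same, sub_sub_sub_cancel_right]
  rw [div_div_div_cancel_right₀ hne]

theorem fieldHom_one : fieldHom k 1 = AlgHom.id k _ := by
  refine genField_algHom_ext k fun i j => ?_
  rw [fieldHom_genMatrix, AlgHom.id_apply]
  rw [permRatio, genMatrix_eq]
  fin_cases i <;> fin_cases j <;> simp

/-- The action of `Σ₃` on the field of rational functions. -/
def fieldAction : Equiv.Perm (Fin 3) →* (GenField k ≃ₐ[k] GenField k) where
  toFun g := AlgEquiv.ofAlgHom (fieldHom k g) (fieldHom k g⁻¹)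
    (by rw [← fieldHom_mul, mul_inv_cancel, fieldHom_one])
    (by rw [← fieldHom_mul, inv_mul_cancel, fieldHom_one])
  map_one' := by
    ext c
    exact DFunLike.congr_fun (fieldHom_one k) c
  map_mul' g h := by
    ext c
    exact DFunLike.congr_fun (fieldHom_mul k g h) c

theorem fieldAction_apply (g : Equiv.Perm (Fin 3)) (c : GenField k) :
    fieldAction k g c = fieldHom k g c := rfl

theorem eval_polyMatrix_of_fieldAction_eq_one {g : Equiv.Perm (Fin 3)}
    (hg : fieldAction k g = 1) (v : Fin 3 → k) (i j : Fin 3) :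
    MvPolynomial.eval v (polyMatrix k (g i) j - polyMatrix k (g 2) j) =
      MvPolynomial.eval v (polyMatrix k i j * (polyMatrix k (g 0) 0 - polyMatrix k (g 2) 0)) := by
  have hne : genMatrix k (g 0) 0 - genMatrix k (g 2) 0 ≠ 0 :=
    genMatrix_sub_ne_zero k (fun h => by simpa using g.injective h)
  congr 1
  apply IsFractionRing.injective (MvPolynomial (Fin 3) k) (GenField k)
  have h : fieldAction k g (genMatrix k i j) = genMatrix k i j := by rw [hg]; rfl
  rw [fieldAction_apply, fieldHom_genMatrix, permRatio, div_eq_iff hne] at h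
  simpa only [map_sub, map_mul, algebraMap_polyMatrix] using h

/-- If g acts trivially, the ratios fixed by g are already fixed at y = (2,3,7), and a check of all
triples of distinct indices leaves only the identity. -/
theorem fieldAction_injective : Function.Injective (fieldAction k) := by
  rw [injective_iff_map_eq_one]
  intro g hg
  have h1 := eval_polyMatrix_of_fieldAction_eq_one k hg ![2, 3, 7] 0 1
  have h2 := eval_polyMatrix_of_fieldAction_eq_one k hg ![2, 3, 7] 1 0
  have h01 : g 0 ≠ g 1 := fun h => by simpa using g.injective h
  have h02 : g 0 ≠ g 2 := fun h => by simpa using g.injective h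
  have h12 : g 1 ≠ g 2 := fun h => by simpa using g.injective h
  have key : ∀ a b c : Fin 3, a ≠ b → a ≠ c → b ≠ c →
      MvPolynomial.eval ![2, 3, 7] (polyMatrix k a 1 - polyMatrix k c 1) =
        MvPolynomial.eval ![2, 3, 7]
          (polyMatrix k 0 1 * (polyMatrix k a 0 - polyMatrix k c 0)) →
      MvPolynomial.eval ![2, 3, 7] (polyMatrix k b 0 - polyMatrix k c 0) =
        MvPolynomial.eval ![2, 3, 7]
          (polyMatrix k 1 0 * (polyMatrix k a 0 - polyMatrix k c 0)) →
      a = 0 ∧ b = 1 ∧ c = 2 := by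
    intro a b c
    fin_cases a <;> fin_cases b <;> fin_cases c <;> simp [polyMatrix] <;> norm_num
  obtain ⟨h0, h1, h2⟩ := key _ _ _ h01 h02 h12 h1 h2
  ext i
  fin_cases i <;> simp [h0, h1, h2]

theorem fieldAction_swap_zero_one :
    fieldAction k (Equiv.swap 0 1) (y k 0) = y k 2 / y k 1 ∧
      fieldAction k (Equiv.swap 0 1) (y k 1) = 1 / y k 1 ∧
      fieldAction k (Equiv.swap 0 1) (y k 2) = y k 0 / y k 1 := by
  have h : (Equiv.swap 0 1 : Equiv.Perm (Fin 3)) 2 = 2 := by decide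
  simp [fieldAction_apply, fieldHom_y, permImage, permRatio, genMatrix_eq, h]

theorem fieldAction_swap_zero_two :
    fieldAction k (Equiv.swap 0 2) (y k 0) = y k 0 ∧
      fieldAction k (Equiv.swap 0 2) (y k 1) = 1 - y k 1 ∧
      fieldAction k (Equiv.swap 0 2) (y k 2) = y k 0 - y k 2 := by
  have h : (Equiv.swap 0 2 : Equiv.Perm (Fin 3)) 1 = 1 := by decide
  simp [fieldAction_apply, fieldHom_y, permImage, permRatio, genMatrix_eq, h, div_neg]

end FieldAction

/-! ### Semilinear maps as linear maps into a twisted algebra. -/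

section Semilinear

variable {K : Type u} [Field K] {A : Type*} [Ring A] [Algebra K A]

/-- The ring `A`, with scalars acting through the ring endomorphism `σ` of `K`. -/
def Twisted (_σ : K →+* K) (A : Type*) : Type _ := A

instance (σ : K →+* K) : Ring (Twisted σ A) := inferInstanceAs (Ring A)

instance (σ : K →+* K) : Algebra K (Twisted σ A) :=
  (Algebra.compHom A σ : Algebra K A)

theorem exists_semilinear_lift (σ : K →+* K) (x : Fin 2 × Fin 2 → K) {P Q : Fin 3 → A}
    (hP : CompleteOrthogonalIdempotents P) (hQ : CompleteOrthogonalIdempotents Q)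
    (h : relation (fun t => σ (x t)) P Q = 0) :
    ∃ f : S x →+* A, (∀ c s, f (c • s) = σ c • f s) ∧
      (∀ i, f (toS x (p K i)) = P i) ∧ ∀ j, f (toS x (q K j)) = Q j := by
  let F : S x →ₐ[K] Twisted σ A := liftS (A := Twisted σ A) x hP hQ h
  exact ⟨F.toRingHom, fun c s => map_smul F c s, liftS_p (A := Twisted σ A) x hP hQ h,
    liftS_q (A := Twisted σ A) x hP hQ h⟩

/-- A semilinear ring homomorphism as an algebra homomorphism to the twisted algebra. -/
def toTwisted (σ : K →+* K) {x : Fin 2 × Fin 2 → K} (f : S x →+* A)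
    (hf : ∀ c s, f (c • s) = σ c • f s) : S x →ₐ[K] Twisted σ A :=
  { (f : S x →+* Twisted σ A) with
    commutes' := fun c => by
      have h := hf c 1
      rw [map_one, ← Algebra.algebraMap_eq_smul_one, ← Algebra.algebraMap_eq_smul_one] at h
      exact h }

theorem semilinear_ext (σ : K →+* K) {x : Fin 2 × Fin 2 → K} {f g : S x →+* A}
    (hf : ∀ c s, f (c • s) = σ c • f s) (hg : ∀ c s, g (c • s) = σ c • g s)
    (hp : ∀ i, f (toS x (p K i)) = g (toS x (p K i)))
    (hq : ∀ j, f (toS x (q K j)) = g (toS x (q K j))) : f = g := by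
  have : toTwisted σ f hf = toTwisted σ g hg := S_algHom_ext hp hq
  exact RingHom.ext fun s => DFunLike.congr_fun this s

end Semilinear

/-! ### The semilinear action on the generic algebra. -/

section AlgebraAction

variable (k : Type u) [Field k] [CharZero k]

/-- After reindexing by g this is a scalar multiple of the old relation minus ∑ M (g 2) j [∑ P i, Q
j], whose commutators vanish because ∑ P i = 1. -/
theorem relation_fieldHom {A : Type*} [Ring A] [Algebra (GenField k) A] {P Q : Fin 3 → A}
    (hP : CompleteOrthogonalIdempotents P) (h : relation (genPoint k) P Q = 0)
    (g : Equiv.Perm (Fin 3)) :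
    relation (fun t => fieldHom k g (genPoint k t)) (fun i => P (g i)) Q = 0 := by
  rw [relation_eq_sum] at h ⊢
  have hcoeff : ∀ i j, extendedCoeff (fun t => fieldHom k g (genPoint k t)) i j =
      permRatio k g i j := by
    intro i j
    rw [← fieldHom_genMatrix]
    fin_cases i <;> fin_cases j <;> simp [extendedCoeff]
  simp only [hcoeff, permRatio, div_eq_inv_mul, mul_smul, ← Finset.smul_sum]
  rw [Equiv.sum_comp g fun i => ∑ j, (genMatrix k i j - genMatrix k (g 2) j) •
    (P i * Q j - Q j * P i)]
  simp only [sub_smul, Finset.sum_sub_distrib]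
  rw [h, Finset.sum_comm]
  simp only [← Finset.smul_sum, Finset.sum_sub_distrib, ← Finset.sum_mul, ← Finset.mul_sum,
    hP.complete]
  simp

theorem exists_semilinear_map {A : Type*} [Ring A] [Algebra (GenField k) A]
    (π : GenS k →ₐ[GenField k] A) (g : Equiv.Perm (Fin 3)) :
    ∃ f : GenS k →+* A, (∀ c s, f (c • s) = fieldHom k g c • f s) ∧
      (∀ i, f (toS (genPoint k) (p (GenField k) i)) =
        π (toS (genPoint k) (p (GenField k) (g i)))) ∧
      ∀ j, f (toS (genPoint k) (q (GenField k) j)) = π (toS (genPoint k) (q (GenField k) j)) := by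
  have hP : CompleteOrthogonalIdempotents fun i => π (toS (genPoint k) (p (GenField k) i)) :=
    (completeOrthogonalIdempotents_p (genPoint k)).map π.toRingHom
  have hQ : CompleteOrthogonalIdempotents fun i => π (toS (genPoint k) (q (GenField k) i)) :=
    (completeOrthogonalIdempotents_q (genPoint k)).map π.toRingHom
  exact exists_semilinear_lift (fieldHom k g).toRingHom (genPoint k)
    ((CompleteOrthogonalIdempotents.equiv g).2 hP) hQ
    (relation_fieldHom k hP (relation_map (genPoint k) π) g)

theorem exists_semilinear_endomorphism (g : Equiv.Perm (Fin 3)) :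
    ∃ f : GenS k →+* GenS k, (∀ c s, f (c • s) = fieldHom k g c • f s) ∧
      (∀ i, f (toS (genPoint k) (p (GenField k) i)) =
        toS (genPoint k) (p (GenField k) (g i))) ∧
      ∀ j, f (toS (genPoint k) (q (GenField k) j)) = toS (genPoint k) (q (GenField k) j) :=
  exists_semilinear_map (A := GenS k) k (AlgHom.id _ _) g

/-- The semilinear endomorphism of the generic algebra permuting the `p i` by `g`. -/
def semilinearHom (g : Equiv.Perm (Fin 3)) : GenS k →+* GenS k :=
  (exists_semilinear_endomorphism k g).choose

theorem semilinearHom_smul (g : Equiv.Perm (Fin 3)) (c : GenField k) (s : GenS k) :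
    semilinearHom k g (c • s) = fieldHom k g c • semilinearHom k g s :=
  (exists_semilinear_endomorphism k g).choose_spec.1 c s

theorem semilinearHom_p (g : Equiv.Perm (Fin 3)) (i : Fin 3) :
    semilinearHom k g (toS (genPoint k) (p (GenField k) i)) =
      toS (genPoint k) (p (GenField k) (g i)) :=
  (exists_semilinear_endomorphism k g).choose_spec.2.1 i

theorem semilinearHom_q (g : Equiv.Perm (Fin 3)) (j : Fin 3) :
    semilinearHom k g (toS (genPoint k) (q (GenField k) j)) =
      toS (genPoint k) (q (GenField k) j) :=
  (exists_semilinear_endomorphism k g).choose_spec.2.2 j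

theorem semilinearHom_mul (g h : Equiv.Perm (Fin 3)) :
    semilinearHom k (g * h) = (semilinearHom k g).comp (semilinearHom k h) := by
  refine semilinear_ext (A := GenS k) (fieldHom k (g * h)).toRingHom
    (semilinearHom_smul k (g * h)) (fun c s => ?_) (fun i => ?_) (fun j => ?_)
  · change semilinearHom k g (semilinearHom k h (c • s)) =
      fieldHom k (g * h) c • semilinearHom k g (semilinearHom k h s)
    rw [semilinearHom_smul, semilinearHom_smul, fieldHom_mul, AlgHom.comp_apply]
  · change _ = semilinearHom k g (semilinearHom k h _)
    rw [semilinearHom_p, semilinearHom_p, semilinearHom_p, Equiv.Perm.mul_apply]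
  · change _ = semilinearHom k g (semilinearHom k h _)
    rw [semilinearHom_q, semilinearHom_q, semilinearHom_q]

theorem semilinearHom_one : semilinearHom k 1 = RingHom.id (GenS k) := by
  refine semilinear_ext (A := GenS k) (fieldHom k 1).toRingHom
    (semilinearHom_smul k 1) (fun c s => ?_) (fun i => ?_) (fun j => ?_)
  · change c • s = fieldHom k 1 c • s
    rw [fieldHom_one, AlgHom.id_apply]
  · rw [semilinearHom_p]; rfl
  · rw [semilinearHom_q]; rfl

/-- The semilinear action of `Σ₃` on the generic algebra. -/
def algebraAction : Equiv.Perm (Fin 3) →* RingAut (GenS k) where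
  toFun g := RingEquiv.ofRingHom (semilinearHom k g) (semilinearHom k g⁻¹)
    (by rw [← semilinearHom_mul, mul_inv_cancel, semilinearHom_one])
    (by rw [← semilinearHom_mul, inv_mul_cancel, semilinearHom_one])
  map_one' := by
    ext s
    exact DFunLike.congr_fun (semilinearHom_one k) s
  map_mul' g h := by
    ext s
    exact DFunLike.congr_fun (semilinearHom_mul k g h) s

end AlgebraAction

/-! ### Divisibility of the dimension by three. -/

section Divisibility

variable {K A : Type*} [Field K] [Ring A] [Algebra K A]

/-- The right ideal `e * A`, as a subspace. -/
def rightIdeal (K : Type*) [Field K] [Algebra K A] (e : A) : Submodule K A :=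
  LinearMap.range (LinearMap.mulLeft K e)

theorem mul_eq_of_mem_rightIdeal {e a : A} (he : IsIdempotentElem e) (ha : a ∈ rightIdeal K e) :
    e * a = a := by
  obtain ⟨b, rfl⟩ := ha
  simp [← mul_assoc, he.eq]

theorem mul_mem_rightIdeal (e a : A) : e * a ∈ rightIdeal K e := ⟨a, rfl⟩

/-- The Peirce decomposition of `A` into right ideals. -/
def rightPeirceEquiv {P : Fin 3 → A} (hP : CompleteOrthogonalIdempotents P) :
    A ≃ₗ[K] ((i : Fin 3) → rightIdeal K (P i)) where
  toFun a i := ⟨P i * a, mul_mem_rightIdeal _ _⟩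
  map_add' a b := by ext i; simp [mul_add]
  map_smul' c a := by ext i; simp
  invFun f := ∑ i, (f i : A)
  left_inv a := by simp [← Finset.sum_mul, hP.complete]
  right_inv f := by
    ext i
    have : ∀ j, P i * (f j : A) = if i = j then (f j : A) else 0 := by
      intro j
      rw [← mul_eq_of_mem_rightIdeal (hP.idem j) (f j).2, ← mul_assoc, hP.mul_eq]
      split_ifs with h
      · rw [h]
      · rw [zero_mul]
    simp [Finset.mul_sum, this]

/-- Semilinear automorphisms permuting three complete orthogonal idempotents transitively force
the dimension to be divisible by three. -/
theorem three_dvd_finrank [Module.Finite K A] {P : Fin 3 → A}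
    (hP : CompleteOrthogonalIdempotents P) (σ : Fin 3 → K ≃+* K) (τ : Fin 3 → A ≃+* A)
    (hτ : ∀ i c a, τ i (c • a) = σ i c • τ i a) (hτP : ∀ i, τ i (P 0) = P i) :
    3 ∣ Module.finrank K A := by
  have hdim : ∀ i, Module.finrank K (rightIdeal K (P i)) =
      Module.finrank K (rightIdeal K (P 0)) := by
    intro i
    have hsymm : (τ i).symm (P i) = P 0 := by rw [← hτP i, RingEquiv.symm_apply_apply]
    let e : rightIdeal K (P 0) ≃+ rightIdeal K (P i) :=
      { toFun := fun a => ⟨τ i a, by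
          rw [← mul_eq_of_mem_rightIdeal (hP.idem 0) a.2, map_mul, hτP]
          exact mul_mem_rightIdeal _ _⟩
        invFun := fun a => ⟨(τ i).symm a, by
          rw [← mul_eq_of_mem_rightIdeal (hP.idem i) a.2, map_mul, hsymm]
          exact mul_mem_rightIdeal _ _⟩
        left_inv := fun a => by ext; simp
        right_inv := fun a => by ext; simp
        map_add' := fun a b => by ext; simp }
    -- The bijection is only semilinear along σ i, which still preserves rank since σ i is
    -- bijective.
    have := rank_eq_of_equiv_equiv (σ i) e (σ i).bijective
      (fun c a => Subtype.ext (hτ i c a))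
    rw [Module.finrank, Module.finrank, this]
  rw [(rightPeirceEquiv (K := K) hP).finrank_eq, Module.finrank_pi_fintype,
    Finset.sum_congr rfl fun i _ => hdim i]
  simp

theorem three_dvd_finrank_genS (k : Type u) [Field k] [CharZero k] :
    3 ∣ Module.finrank (GenField k) (GenS k) := by
  have := (S_finite_and_finrank_le (discriminant_genPoint_ne_zero k)).1
  refine three_dvd_finrank (A := GenS k) (completeOrthogonalIdempotents_p (genPoint k))
    (fun i => (fieldAction k (Equiv.swap 0 i)).toRingEquiv)
    (fun i => algebraAction k (Equiv.swap 0 i)) (fun i c a => ?_) (fun i => ?_)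
  · exact semilinearHom_smul k _ c a
  · refine (semilinearHom_p k _ _).trans ?_
    rw [Equiv.swap_apply_left]

end Divisibility

end PartialAbelianization

end

open PartialAbelianization in
theorem mainTheorem2 (k : Type*) [Field k] [IsAlgClosed k] [CharZero k] :
    -- `𝒮` is finite-dimensional over `𝔽`, of dimension at most `19`
    (Module.Finite (GenField k) (GenS k) ∧ Module.finrank (GenField k) (GenS k) ≤ 19) ∧
    -- the action of `Σ₃` on `𝔽` over `k` and the compatible semilinear action on `𝒮` by ring
    -- automorphisms that permutes `p₁, p₂, 1 - p₁ - p₂` and fixes `q₁, q₂`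
    (∃ (ρ : Equiv.Perm (Fin 3) →* (GenField k ≃ₐ[k] GenField k))
        (θ : Equiv.Perm (Fin 3) →* RingAut (GenS k)),
      Function.Injective ρ ∧
      (ρ (Equiv.swap 0 1) (y k 0) = y k 2 / y k 1 ∧
        ρ (Equiv.swap 0 1) (y k 1) = 1 / y k 1 ∧
        ρ (Equiv.swap 0 1) (y k 2) = y k 0 / y k 1) ∧
      (ρ (Equiv.swap 0 2) (y k 0) = y k 0 ∧
        ρ (Equiv.swap 0 2) (y k 1) = 1 - y k 1 ∧
        ρ (Equiv.swap 0 2) (y k 2) = y k 0 - y k 2) ∧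
      (∀ (g : Equiv.Perm (Fin 3)) (c : GenField k) (s : GenS k),
        θ g (c • s) = ρ g c • θ g s) ∧
      (∀ (g : Equiv.Perm (Fin 3)) (i : Fin 3),
        θ g (toS (genPoint k) (p (GenField k) i)) =
          toS (genPoint k) (p (GenField k) (g i))) ∧
      (∀ (g : Equiv.Perm (Fin 3)) (j : Fin 3),
        θ g (toS (genPoint k) (q (GenField k) j)) =
          toS (genPoint k) (q (GenField k) j))) ∧
    3 ∣ Module.finrank (GenField k) (GenS k) ∧
    Module.finrank (GenField k) (GenS k) ≤ 18 ∧
    -- for all `x` in a nonempty Zariski open subset of `ℙ³`, `S_x` has dimension at most `18`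
    (∃ U : Set (Projectivization k (Fin 2 × Fin 2 → k)),
      IsZariskiOpen k U ∧ U.Nonempty ∧
      ∀ (x : Fin 2 × Fin 2 → k) (hx : x ≠ 0), Projectivization.mk k x hx ∈ U →
        Module.Finite k (S x) ∧ Module.finrank k (S x) ≤ 18) := by
  have hgen := S_finite_and_finrank_le (discriminant_genPoint_ne_zero k)
  exact ⟨⟨hgen.1, hgen.2.trans (by norm_num)⟩,
    ⟨fieldAction k, algebraAction k, fieldAction_injective k, fieldAction_swap_zero_one k,
      fieldAction_swap_zero_two k, semilinearHom_smul k, semilinearHom_p k, semilinearHom_q k⟩,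
    three_dvd_finrank_genS k, hgen.2,
    ⟨nonvanishingLocus k, isZariskiOpen_nonvanishingLocus k, nonvanishingLocus_nonempty k,
      fun x hx hU => S_finite_and_finrank_le ((mk_mem_nonvanishingLocus k x hx).1 hU)⟩⟩
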